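/- **Setting.** All locally compact spaces are Hausdorff and second countable, and Hilbert spaces are separable. Let $G$ be a locally compact Hausdorff groupoid with unit space $G^0$, range and source maps $r,s$ and a left Haar system $\{\lambda^u\}_{u\in G^0}$. Put $G^u=r^{-1}(u)$, $G_u=s^{-1}(u)$, $D=C_0(G^0)$. A *$G$-Hilbert bundle* is a continuous field of Hilbert spaces $\{H_u\}_{u\in G^0}$ with surjective linear isometries $L_x:H_{s(x)}\to H_{r(x)}$ $(x\in G)$, multiplicative in $x$, such that for all bounded continuous sections $\xi,\eta$ the *coefficient* $(\xi,\eta)(x)=\langle L_x\xi(s(x)),\eta(r(x))\rangle$ is continuous on $G$ (inner products are conjugate linear in the first variable). $B(G)$ is the algebra of all such coefficients, with norm $\|\phi\|=\inf\|\xi\|\,\|\eta\|$ over all representations $\phi=(\xi,\eta)$, where $\|\xi\|=\sup_u\|\xi(u)\|$. Let $A_{cf}(G)$ be the set of functions $(f,g)(x)=\int\overline{f(x^{-1}t)}\,g(t)\,d\lambda^{r(x)}(t)$ with $f,g\in C_c(G)$, let $A_{cf}(V)$ be the set of those $\phi\in A_{cf}(G)$ whose support $S(\phi)$ is contained in $V\subset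 G$, and let $A(G)$ be the closure in $B(G)$ of the algebra generated by $A_{cf}(G)$ under pointwise operations. $D$ acts on functions on $G$ by $(\phi b)(x)=\phi(x)b(r(x))$ and $(b\phi)(x)=b(s(x))\phi(x)$. **Part 1.** Let $\alpha:A(G)\to D$ be a bounded linear map with $\alpha(\phi b)=\alpha(\phi)b$ $(b\in D)$ and $\alpha(\phi\psi)=\alpha(\phi)\alpha(\psi)$. Let $A$ be the set of $x\in G$ such that for every neighborhood $V$ of $x$ there is $\phi\in A_{cf}(V)$ with $\alpha(\phi)(r(x))\neq0$. Let $N$ be the set of $x\in G$ that have an open neighborhood $U$ with $\alpha(\phi)=0$ for all $\phi\in A_{cf}(U)$. Put $A^0=r(A)$, $B^0=G^0\setminus A^0$. Then: 1. for every $u\in A^0$ the set $A\cap G^u$ is a singleton $\{x^u\}$; 2. for every $u\in A^0$, $G^u\setminus\{x^u\}\subset N$; 3. if $u\in B^0$ and $\phi\in A_{cf}(G)$, then $\alpha(\phi)(u)=0$; 4. if $u\in G^0$, $\phi\in A_{cf}(G)$ and $S(\phi)\cap G^u\subset N$, then $\alpha(\phi)=0$ in a neighborhood of $u$ in $G^0$;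 5. $A^0$ is open in $G^0$; 6. the map $u\mapsto x^u$ is continuous from $A^0$ into $G$; 7. if $\phi\in A_{cf}(G)$ and $S(\phi)\subset G\setminus\{x^u:u\in A^0\}$, then $\alpha(\phi)=0$. **Part 2.** Let $E^2$ be the Hilbert $D$-module of continuous sections of $\{L^2(G^u,\lambda^u)\}_u$ vanishing at infinity; it contains $C_c(G)$ as a dense subspace. Let $\Phi_{A(G)}$ be the set of pairs $(\alpha,\beta)$ of bounded linear maps $A(G)\to D$ such that (i) $\alpha(\phi b)=\alpha(\phi)b$ and $\beta(b\phi)=b\beta(\phi)$ for $b\in D$; (ii) for every $u\in G^0$ there is $\phi\in A(G)$ with $\alpha(\phi)(u)\ne0$; (iii) there is a homeomorphism $J$ of $G^0$ with $\beta(\phi)\circ J=\alpha(\phi)$ for all $\phi\in A(G)$; (iv) for every $f\in C_c(G)$ the map $g\mapsto\alpha(g*f)$ on $C_c(G)$ extends to a compact module operator from $E^2$ to $D$, i.e. to an element of the operator norm closure of the span of the maps $g\mapsto h\langle k,g\rangle$ with $h\in D$, $k\in E^2$; (v) $\alpha$ is multiplicative. A *bisection* of $G$ is a set $B\subset G$ that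 meets every $G^u$ in exactly one point $b^u$ and every $G_u$ in exactly one point $b_u$, such that $u\mapsto b^u$ and $u\mapsto b_u$ are homeomorphisms of $G^0$ onto $B$. Let $(\alpha,\beta)\in\Phi_{A(G)}$, and let $A$ be the set of Part 1 for $\alpha$ and $A'$ the set of $x\in G$ such that for every neighborhood $V$ of $x$ there is $\phi\in A_{cf}(V)$ with $\beta(\phi)(s(x))\ne0$. Then for every $u\in G^0$ the sets $A\cap G^u$ and $A'\cap G_u$ are singletons $\{\gamma(u)\}$ and $\{\delta(u)\}$, and there is a bisection $B$ of $G$ such that $r|_B,s|_B:B\to G^0$ are homeomorphisms with $\gamma=(r|_B)^{-1}$ and $\delta=(s|_B)^{-1}$. -/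

import Mathlib

open Set Filter Topology MeasureTheory
open scoped ENNReal NNReal ZeroAtInfty CompactlySupported ComplexConjugate

universe u

/-- A topological groupoid with arrow space `G` and unit space `X`. The unit space is identified
with its image in `G` under the embedding `unit` (a topological embedding, since `r` is a
continuous left inverse). The product `x y` is meaningful exactly when `s x = r y`; the values of
the total function `mul` on other pairs are irrelevant. -/
structure TopGroupoid (G X : Type u) [TopologicalSpace G] [TopologicalSpace X] where
  r : G → X
  s : G → X
  unit : X → G
  mul : G → G → G
  inv : G → G
  r_unit : ∀ a, r (unit a) = a
  s_unit : ∀ a, s (unit a) = a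
  r_mul : ∀ {x y}, s x = r y → r (mul x y) = r x
  s_mul : ∀ {x y}, s x = r y → s (mul x y) = s y
  mul_assoc : ∀ {x y z}, s x = r y → s y = r z → mul (mul x y) z = mul x (mul y z)
  unit_mul : ∀ x, mul (unit (r x)) x = x
  mul_unit : ∀ x, mul x (unit (s x)) = x
  r_inv : ∀ x, r (inv x) = s x
  s_inv : ∀ x, s (inv x) = r x
  mul_inv : ∀ x, mul x (inv x) = unit (r x)
  inv_mul : ∀ x, mul (inv x) x = unit (s x)
  continuous_r : Continuous r
  continuous_s : Continuous s
  continuous_unit : Continuous unit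
  continuous_inv : Continuous inv
  continuousOn_mul : ContinuousOn (fun p : G × G => mul p.1 p.2) {p | s p.1 = r p.2}

namespace TopGroupoid

variable {G X : Type u} [TopologicalSpace G] [TopologicalSpace X] (𝒢 : TopGroupoid G X)

/-- The fiber `G^a = r⁻¹{a}`. -/
def rFiber (a : X) : Set G := 𝒢.r ⁻¹' {a}

/-- The fiber `G_a = s⁻¹{a}`. -/
def sFiber (a : X) : Set G := 𝒢.s ⁻¹' {a}

/-- An `r`-section: every `B ∩ G^a` is a singleton `{b^a}` and `a ↦ b^a` is a homeomorphism of the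
unit space onto `B`. -/
def IsRSection (B : Set G) : Prop :=
  ∃ b : X ≃ₜ B, ∀ a, B ∩ 𝒢.rFiber a = {(b a : G)}

/-- An `s`-section: every `B ∩ G_a` is a singleton `{b_a}` and `a ↦ b_a` is a homeomorphism of the
unit space onto `B`. -/
def IsSSection (B : Set G) : Prop :=
  ∃ b : X ≃ₜ B, ∀ a, B ∩ 𝒢.sFiber a = {(b a : G)}

/-- A bisection is both an `r`-section and an `s`-section. -/
def IsBisection (B : Set G) : Prop := 𝒢.IsRSection B ∧ 𝒢.IsSSection B

theorem inv_eq_of_mul_eq {x y : G} (h : 𝒢.s x = 𝒢.r y)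
    (hxy : 𝒢.mul x y = 𝒢.unit (𝒢.r x)) : 𝒢.inv x = y := by
  have h1 : 𝒢.mul (𝒢.inv x) (𝒢.mul x y) = y := by
    rw [← 𝒢.mul_assoc (𝒢.s_inv x) h, 𝒢.inv_mul, h, 𝒢.unit_mul]
  rw [hxy, ← 𝒢.s_inv x, 𝒢.mul_unit] at h1
  exact h1

theorem inv_inv_mul {x t : G} (h : 𝒢.r t = 𝒢.r x) :
    𝒢.inv (𝒢.mul (𝒢.inv x) t) = 𝒢.mul (𝒢.inv t) x := by
  have h1 : 𝒢.s (𝒢.inv x) = 𝒢.r t := by rw [𝒢.s_inv, h]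
  have h2 : 𝒢.s (𝒢.inv t) = 𝒢.r x := by rw [𝒢.s_inv, h]
  have h3 : 𝒢.s t = 𝒢.r (𝒢.mul (𝒢.inv t) x) := by rw [𝒢.r_mul h2, 𝒢.r_inv]
  apply 𝒢.inv_eq_of_mul_eq
  · rw [𝒢.s_mul h1, h3]
  · rw [𝒢.mul_assoc h1 h3, ← 𝒢.mul_assoc (𝒢.r_inv t).symm h2, 𝒢.mul_inv, h, 𝒢.unit_mul,
      𝒢.inv_mul, 𝒢.r_mul h1, 𝒢.r_inv]

end TopGroupoid

/-- A left Haar system: Radon measures `λ^a` with support equal to `G^a`, continuous in `a` and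
left invariant. (On a second countable locally compact Hausdorff space a Borel measure that is
finite on compact sets is regular.) -/
structure HaarSystem {G X : Type u} [TopologicalSpace G] [TopologicalSpace X]
    [MeasurableSpace G] (𝒢 : TopGroupoid G X) where
  meas : X → Measure G
  finiteOnCompacts : ∀ a, IsFiniteMeasureOnCompacts (meas a)
  null_compl : ∀ a, meas a (𝒢.rFiber a)ᶜ = 0
  pos_of_isOpen : ∀ a (U : Set G), IsOpen U → (U ∩ 𝒢.rFiber a).Nonempty → 0 < meas a U
  continuous_integral : ∀ f : C_c(G, ℂ), Continuous fun a => ∫ t, f t ∂(meas a)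
  left_invariant : ∀ (x : G) (f : C_c(G, ℂ)),
    ∫ t, f (𝒢.mul x t) ∂(meas (𝒢.s x)) = ∫ t, f t ∂(meas (𝒢.r x))

attribute [instance] HaarSystem.finiteOnCompacts

/-- A continuous Hilbert bundle over `X`, that is, a continuous field of (separable) Hilbert
spaces in the sense of Dixmier, given by its space of continuous sections. -/
structure HilbertBundle (X : Type u) [TopologicalSpace X] where
  fiber : X → Type u
  [normed : ∀ a, NormedAddCommGroup (fiber a)]
  [innerProduct : ∀ a, InnerProductSpace ℂ (fiber a)]
  [complete : ∀ a, CompleteSpace (fiber a)]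
  [separable : ∀ a, TopologicalSpace.SeparableSpace (fiber a)]
  contSections : Submodule ℂ ((a : X) → fiber a)
  dense_eval : ∀ a, Dense ((fun ξ : (a : X) → fiber a => ξ a) '' contSections)
  continuous_norm : ∀ ξ ∈ contSections, Continuous fun a => ‖ξ a‖
  mem_of_locally_close : ∀ ξ : (a : X) → fiber a,
    (∀ a₀, ∀ ε : ℝ, 0 < ε → ∃ η ∈ contSections, ∀ᶠ a in 𝓝 a₀, ‖ξ a - η a‖ ≤ ε) →
      ξ ∈ contSections

attribute [instance] HilbertBundle.normed HilbertBundle.innerProduct HilbertBundle.complete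
  HilbertBundle.separable

/-- The space `Δ_b` of bounded continuous sections. -/
def HilbertBundle.bddSections {X : Type u} [TopologicalSpace X] (ℋ : HilbertBundle X) :
    Set ((a : X) → ℋ.fiber a) :=
  {ξ | ξ ∈ ℋ.contSections ∧ ∃ C : ℝ, ∀ a, ‖ξ a‖ ≤ C}

/-- The norm of a section, `sup_a ‖ξ a‖`, as an extended nonnegative real. -/
noncomputable def HilbertBundle.secNorm {X : Type u} [TopologicalSpace X] (ℋ : HilbertBundle X)
    (ξ : (a : X) → ℋ.fiber a) : ℝ≥0∞ :=
  ⨆ a, ‖ξ a‖ₑ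

/-- A `G`-Hilbert bundle: a continuous Hilbert bundle over the unit space with surjective linear
isometries `L_x : H_{s x} → H_{r x}`, multiplicative in `x`, with continuous coefficients.
Here `L x hs hr` is `L_x`, where the equations `hs : s x = a` and `hr : r x = b` only serve to
name the source and the target fiber. -/
structure GHilbertBundle {G X : Type u} [TopologicalSpace G] [TopologicalSpace X]
    (𝒢 : TopGroupoid G X) extends HilbertBundle X where
  L : ∀ (x : G) {a b : X}, 𝒢.s x = a → 𝒢.r x = b → (fiber a ≃ₗᵢ[ℂ] fiber b)
  L_mul : ∀ (x y : G) {a b c : X} (hya : 𝒢.s y = a) (hyb : 𝒢.r y = b) (hxb : 𝒢.s x = b)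
    (hxc : 𝒢.r x = c) (v : fiber a),
    L (𝒢.mul x y) ((𝒢.s_mul (hxb.trans hyb.symm)).trans hya)
      ((𝒢.r_mul (hxb.trans hyb.symm)).trans hxc) v = L x hxb hxc (L y hya hyb v)
  continuous_coeff : ∀ ξ ∈ toHilbertBundle.bddSections, ∀ η ∈ toHilbertBundle.bddSections,
    Continuous fun x => inner ℂ (L x rfl rfl (ξ (𝒢.s x))) (η (𝒢.r x))

/-- The coefficient `(ξ, η)(x) = ⟨L_x ξ(s x), η(r x)⟩` (conjugate linear in the first variable). -/
noncomputable def GHilbertBundle.coeff {G X : Type u} [TopologicalSpace G] [TopologicalSpace X]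
    {𝒢 : TopGroupoid G X} (ℋ : GHilbertBundle 𝒢) (ξ η : (a : X) → ℋ.fiber a) : G → ℂ :=
  fun x => inner ℂ (ℋ.L x rfl rfl (ξ (𝒢.s x))) (η (𝒢.r x))

/-- The norm of the Fourier-Stieltjes algebra `B(G)`: the infimum of `‖ξ‖ ‖η‖` over all ways to
write `φ` as a coefficient `(ξ, η)` of bounded continuous sections of a `G`-Hilbert bundle. It is
`∞` exactly when `φ` does not belong to `B(G)`. -/
noncomputable def bNorm {G X : Type u} [TopologicalSpace G] [TopologicalSpace X]
    (𝒢 : TopGroupoid G X) (φ : G → ℂ) : ℝ≥0∞ :=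
  ⨅ (ℋ : GHilbertBundle 𝒢) (ξ ∈ ℋ.bddSections) (η ∈ ℋ.bddSections) (_ : φ = ℋ.coeff ξ η),
    ℋ.secNorm ξ * ℋ.secNorm η

/-- The `G`-Hilbert bundle with zero fibers. -/
noncomputable def zeroBundle {G X : Type u} [TopologicalSpace G] [TopologicalSpace X]
    (𝒢 : TopGroupoid G X) : GHilbertBundle 𝒢 where
  fiber := fun _ => PUnit
  contSections := ⊤
  dense_eval := fun a => by
    intro v
    exact subset_closure ⟨fun _ => v, trivial, rfl⟩
  continuous_norm := fun ξ _ => by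
    have : (fun a : X => ‖ξ a‖) = fun _ => (0 : ℝ) := by
      funext a
      simp
    rw [this]
    exact continuous_const
  mem_of_locally_close := fun _ _ => trivial
  L := fun _ _ _ _ _ => LinearIsometryEquiv.refl ℂ PUnit
  L_mul := fun _ _ _ _ _ _ _ _ _ _ => rfl
  continuous_coeff := fun ξ _ η _ => continuous_of_const fun _ _ => rfl

theorem bNorm_zero {G X : Type u} [TopologicalSpace G] [TopologicalSpace X]
    (𝒢 : TopGroupoid G X) : bNorm 𝒢 0 = 0 := by
  refine le_antisymm ?_ zero_le
  have hmem : (0 : (a : X) → (zeroBundle 𝒢).fiber a) ∈ (zeroBundle 𝒢).bddSections :=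
    ⟨Submodule.zero_mem _, 0, fun a => by simp⟩
  refine (iInf_le_of_le (zeroBundle 𝒢) <| iInf₂_le_of_le 0 hmem <| iInf₂_le_of_le 0 hmem <|
    iInf_le_of_le ?_ le_rfl).trans ?_
  · funext x
    simp [GHilbertBundle.coeff]
  · simp [HilbertBundle.secNorm]

section Fourier

variable {G X : Type u} [TopologicalSpace G] [TopologicalSpace X] [MeasurableSpace G]
  {𝒢 : TopGroupoid G X} (Λ : HaarSystem 𝒢)

/-- The coefficient of the left regular bundle `{L²(G^a)}`, with action `(L_x ξ)(t) = ξ(x⁻¹ t)`: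
`(f, g)(x) = ∫ conj (f (x⁻¹ t)) g(t) dλ^{r x}(t)`. -/
noncomputable def regCoeff (f g : C_c(G, ℂ)) : G → ℂ :=
  fun x => ∫ t, conj (f (𝒢.mul (𝒢.inv x) t)) * g t ∂(Λ.meas (𝒢.r x))

/-- Convolution `(f * g)(x) = ∫ f(t) g(t⁻¹ x) dλ^{r x}(t)`. -/
noncomputable def conv (f g : C_c(G, ℂ)) : G → ℂ :=
  fun x => ∫ t, f t * g (𝒢.mul (𝒢.inv t) x) ∂(Λ.meas (𝒢.r x))

/-- `A_cf(G)`: the coefficients `(f, g)` with `f, g` in `C_c(G)`. -/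
def Acf : Set (G → ℂ) := {φ | ∃ f g : C_c(G, ℂ), φ = regCoeff Λ f g}

/-- `A_c(G)`: the (nonunital) algebra generated by `A_cf(G)` under pointwise operations. -/
def Ac : NonUnitalSubalgebra ℂ (G → ℂ) := NonUnitalAlgebra.adjoin ℂ (Acf Λ)

/-- The Fourier algebra `A(G)`: the closure of `A_c(G)` in `B(G)`. (Since `A_c(G) ⊆ B(G)` and
`B(G)` is a vector space, a function at finite `bNorm`-distance from `A_c(G)` lies in `B(G)`.) -/
def fourierAlgebra : Set (G → ℂ) :=
  {φ | ∀ ε : ℝ≥0∞, 0 < ε → ∃ ψ ∈ Ac Λ, bNorm 𝒢 (φ - ψ) < ε}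

theorem Acf_subset_fourierAlgebra : Acf Λ ⊆ fourierAlgebra Λ := by
  intro φ hφ ε hε
  refine ⟨φ, NonUnitalAlgebra.subset_adjoin ℂ hφ, ?_⟩
  rw [sub_self, bNorm_zero]
  exact hε

/-- `g * f` is the coefficient `(f*, g)`, where `f*(x) = conj (f x⁻¹)`. -/
theorem conv_mem_Acf (g f : C_c(G, ℂ)) : conv Λ g f ∈ Acf Λ := by
  have hinv : ∀ x, 𝒢.inv (𝒢.inv x) = x := fun x =>
    𝒢.inv_eq_of_mul_eq (𝒢.s_inv x) (by rw [𝒢.inv_mul, 𝒢.r_inv])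
  let e : G ≃ₜ G := ⟨⟨𝒢.inv, 𝒢.inv, hinv, hinv⟩, 𝒢.continuous_inv, 𝒢.continuous_inv⟩
  let F : C_c(G, ℂ) :=
    { toFun := fun x => conj (f (𝒢.inv x))
      continuous_toFun := Complex.continuous_conj.comp (f.continuous.comp 𝒢.continuous_inv)
      hasCompactSupport' :=
        (f.hasCompactSupport.comp_homeomorph e).comp_left (g := fun z => conj z) (map_zero _) }
  refine ⟨F, g, ?_⟩
  funext x
  refine integral_congr_ae ?_
  have hae : ∀ᵐ t ∂(Λ.meas (𝒢.r x)), t ∈ 𝒢.rFiber (𝒢.r x) := Λ.null_compl (𝒢.r x)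
  filter_upwards [hae] with t ht
  have ht' : 𝒢.r t = 𝒢.r x := ht
  change g t * f (𝒢.mul (𝒢.inv t) x) = conj (conj (f (𝒢.inv (𝒢.mul (𝒢.inv x) t)))) * g t
  rw [𝒢.inv_inv_mul ht', Complex.conj_conj, mul_comm]

/-- A bounded linear map from `A(G)` (with the norm of `B(G)`) to `C₀(X)`. The relational form of
the first two fields says that the map is linear, `A(G)` being a vector space; likewise below,
as `A(G)` is an algebra and a `C₀(X)`-bimodule. -/
structure IsBoundedLinear (α : fourierAlgebra Λ → C₀(X, ℂ)) : Prop where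
  map_add : ∀ φ ψ χ : fourierAlgebra Λ, (χ : G → ℂ) = (φ : G → ℂ) + ψ → α χ = α φ + α ψ
  map_smul : ∀ (c : ℂ) (φ χ : fourierAlgebra Λ), (χ : G → ℂ) = c • (φ : G → ℂ) → α χ = c • α φ
  bound : ∃ C : ℝ≥0, ∀ φ : fourierAlgebra Λ, ‖α φ‖ₑ ≤ C * bNorm 𝒢 φ

/-- `α (φ b) = α(φ) b` for `b` in `C₀(X)`, where `(φ b)(x) = φ(x) b(r x)`. -/
def IsRightModuleMap (α : fourierAlgebra Λ → C₀(X, ℂ)) : Prop :=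
  ∀ (b : C₀(X, ℂ)) (φ χ : fourierAlgebra Λ),
    (χ : G → ℂ) = (fun x => (φ : G → ℂ) x * b (𝒢.r x)) → α χ = α φ * b

/-- `β (b φ) = b β(φ)` for `b` in `C₀(X)`, where `(b φ)(x) = b(s x) φ(x)`. -/
def IsLeftModuleMap (β : fourierAlgebra Λ → C₀(X, ℂ)) : Prop :=
  ∀ (b : C₀(X, ℂ)) (φ χ : fourierAlgebra Λ),
    (χ : G → ℂ) = (fun x => b (𝒢.s x) * (φ : G → ℂ) x) → β χ = b * β φ

/-- `α (φ ψ) = α(φ) α(ψ)`, all products being pointwise. -/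
def IsMultiplicative (α : fourierAlgebra Λ → C₀(X, ℂ)) : Prop :=
  ∀ φ ψ χ : fourierAlgebra Λ, (χ : G → ℂ) = (φ : G → ℂ) * ψ → α χ = α φ * α ψ

/-- `Φ^r_{A(G)}`: the multiplicative bounded right module maps from `A(G)` to `C₀(X)`. -/
structure IsMulRightModuleMap (α : fourierAlgebra Λ → C₀(X, ℂ)) : Prop where
  boundedLinear : IsBoundedLinear Λ α
  right : IsRightModuleMap Λ α
  mul : IsMultiplicative Λ α

/-- `A_cf(V)`: the elements of `A_cf(G)` (all of which lie in `C_c(G)`) with support in `V`, as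
elements of `A(G)`. -/
def AcfOn (V : Set G) : Set (fourierAlgebra Λ) :=
  {φ | (φ : G → ℂ) ∈ Acf Λ ∧ tsupport (φ : G → ℂ) ⊆ V}

/-- The set `A` of support points of `α`, relative to the range map. -/
def supportSet (α : fourierAlgebra Λ → C₀(X, ℂ)) : Set G :=
  {x | ∀ V ∈ 𝓝 x, ∃ φ ∈ AcfOn Λ V, α φ (𝒢.r x) ≠ 0}

/-- The set of support points of `β`, relative to the source map; this is the support set of `β`
for the groupoid with reversed multiplication, which has the same `A_cf` and the same `A(G)`. -/
def sSupportSet (β : fourierAlgebra Λ → C₀(X, ℂ)) : Set G :=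
  {x | ∀ V ∈ 𝓝 x, ∃ φ ∈ AcfOn Λ V, β φ (𝒢.s x) ≠ 0}

/-- The set `N` of points near which `α` vanishes. -/
def nullSet (α : fourierAlgebra Λ → C₀(X, ℂ)) : Set G :=
  {x | ∃ U : Set G, IsOpen U ∧ x ∈ U ∧ ∀ φ ∈ AcfOn Λ U, α φ = 0}

/-- The set `A⁰ = r(A)`. -/
def baseSet (α : fourierAlgebra Λ → C₀(X, ℂ)) : Set X := 𝒢.r '' supportSet Λ α

variable [BorelSpace G]

/-- The class of `f` restricted to `G^a` in `L²(G^a, λ^a)`; the latter is realised as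
`L²(G, λ^a)`, as `λ^a` is carried by `G^a`. -/
noncomputable def restr (f : C_c(G, ℂ)) (a : X) : Lp ℂ 2 (Λ.meas a) :=
  (f.continuous.memLp_of_hasCompactSupport f.hasCompactSupport).toLp f

/-- The norm of `g` in `E²`, `sup_a ‖g^a‖`. -/
noncomputable def e2Norm (g : C_c(G, ℂ)) : ℝ := ⨆ a, ‖restr Λ g a‖

/-- The Hilbert `C₀(X)`-module `E²`: the sections of the bundle `{L²(G^a)}` that are continuous,
i.e. locally uniformly close to sections `a ↦ f^a` with `f` in `C_c(G)`, and vanish at infinity. -/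
def E2 : Set ((a : X) → Lp ℂ 2 (Λ.meas a)) :=
  {ξ | (∀ a₀, ∀ ε : ℝ, 0 < ε → ∃ f : C_c(G, ℂ), ∀ᶠ a in 𝓝 a₀, ‖ξ a - restr Λ f a‖ ≤ ε) ∧
    Tendsto (fun a => ‖ξ a‖) (cocompact X) (𝓝 0)}

/-- For every `f` in `C_c(G)`, the bounded map `g ↦ α(g * f)`, defined on the dense subspace
`C_c(G)` of `E²`, extends to an element of `𝔎(E², C₀(X))`, the operator norm closure of the span
of the maps `g ↦ h ⟨k, g⟩` with `h` in `C₀(X)` and `k` in `E²`. (By density, operator norms are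
computed on `C_c(G)`.) -/
def IsCompactType (α : fourierAlgebra Λ → C₀(X, ℂ)) : Prop :=
  ∀ f : C_c(G, ℂ), ∀ ε : ℝ, 0 < ε →
    ∃ (n : ℕ) (h : Fin n → C₀(X, ℂ)) (k : Fin n → (a : X) → Lp ℂ 2 (Λ.meas a)),
      (∀ i, k i ∈ E2 Λ) ∧
      ∀ (g : C_c(G, ℂ)) (a : X),
        ‖α ⟨conv Λ g f, Acf_subset_fourierAlgebra Λ (conv_mem_Acf Λ g f)⟩ a
          - ∑ i, h i a * inner ℂ (k i a) (restr Λ g a)‖ ≤ ε * e2Norm Λ g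

/-- `Φ_{A(G)}`: the multiplicative module maps `(α, β)` on `A(G)`. The restriction of `α` to the
subspace of sums `∑ gₙ * fₙ` of trace class type is automatically a bounded module map, and only
its compactness enters as a condition. -/
structure IsMulModuleMap (α β : fourierAlgebra Λ → C₀(X, ℂ)) : Prop where
  boundedLinear_fst : IsBoundedLinear Λ α
  boundedLinear_snd : IsBoundedLinear Λ β
  right : IsRightModuleMap Λ α
  left : IsLeftModuleMap Λ β
  nonvanishing : ∀ a, ∃ φ : fourierAlgebra Λ, α φ a ≠ 0
  linked : ∃ J : X ≃ₜ X, ∀ (φ : fourierAlgebra Λ) (a : X), β φ (J a) = α φ a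
  compactType : IsCompactType Λ α
  mul : IsMultiplicative Λ α

end Fourier

/-! At a point `a`, `φ ↦ α φ a` is a character that sees `φ` only near `r⁻¹(a)`, because `α` is a
right module map. It should therefore be evaluation at one point of the fiber, and the support set
makes this precise.

The engine is `exists_local_unit`: `A_cf(G)` contains functions equal to 1 near a given point and
supported in a prescribed neighborhood. If `α` vanishes at `a` on functions concentrated near each
point of `S(φ) ∩ G^a`, finitely many local units `χᵢ` cover this compact set. Multiplying `φ` by `∏
(1 - χᵢ)` does not change `α φ a`, while a cut-off in `r` makes the product zero
(`eventually_apply_eq_zero`). This yields support points wherever `α` does not vanish, and local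
vanishing of `α φ` along the null set. Uniqueness holds because functions with disjoint supports
have product zero; continuity follows from the two facts together.

For a pair `(α, β)`, the two module properties and the link `J` force `s = J ∘ r` on both support
sets. Hence they coincide, and this common set is the bisection. -/

section Bumps

variable {Y : Type*} [TopologicalSpace Y] [LocallyCompactSpace Y] [T2Space Y]

theorem exists_compactlySupported_bump {K U : Set Y} (hK : IsCompact K) (hU : IsOpen U)
    (hKU : K ⊆ U) : ∃ f : C_c(Y, ℂ), ∃ g : Y → ℝ, (∀ y, f y = g y) ∧ Continuous g ∧
      HasCompactSupport g ∧ (∀ y, 0 ≤ g y) ∧ (∀ y ∈ K, g y = 1) ∧ (∀ y ∉ U, g y = 0) := by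
  obtain ⟨g, h1, h0, hc, h⟩ := exists_continuous_one_zero_of_isCompact hK hU.isClosed_compl
    (disjoint_compl_right_iff_subset.mpr hKU)
  exact ⟨⟨⟨fun y => (g y : ℂ), Complex.continuous_ofReal.comp g.continuous⟩,
    hc.comp_left (g := fun z : ℝ => (z : ℂ)) Complex.ofReal_zero⟩, g, fun _ => rfl, g.continuous,
    hc, fun y => (h y).1, fun y hy => h1 hy, fun y hy => h0 hy⟩

theorem exists_zeroAtInfty_bump {K U : Set Y} (hK : IsCompact K) (hU : IsOpen U)
    (hKU : K ⊆ U) : ∃ b : C₀(Y, ℂ), (∀ y ∈ K, b y = 1) ∧ (∀ y ∉ U, b y = 0) := by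
  obtain ⟨f, g, hfg, -, -, -, h1, h0⟩ := exists_compactlySupported_bump hK hU hKU
  refine ⟨⟨⟨f, f.continuous⟩, f.hasCompactSupport.is_zero_at_infty⟩, fun y hy => ?_, fun y hy => ?_⟩
  · change f y = 1
    rw [hfg, h1 y hy, Complex.ofReal_one]
  · change f y = 0
    rw [hfg, h0 y hy, Complex.ofReal_zero]

/-- The product of a compactly supported function with a continuous function. -/
noncomputable def CompactlySupportedContinuousMap.mulContinuous (f : C_c(Y, ℂ)) (c : Y → ℂ)
    (hc : Continuous c) : C_c(Y, ℂ) where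
  toFun y := f y * c y
  continuous_toFun := f.continuous.mul hc
  hasCompactSupport' := f.hasCompactSupport.mul_right

end Bumps

/-! ### Groupoid identities -/

namespace TopGroupoid

variable {G X : Type u} [TopologicalSpace G] [TopologicalSpace X] (𝒢 : TopGroupoid G X)

theorem inv_unit (a : X) : 𝒢.inv (𝒢.unit a) = 𝒢.unit a := by
  have h := 𝒢.unit_mul (𝒢.unit a)
  rw [𝒢.r_unit] at h
  exact 𝒢.inv_eq_of_mul_eq (by rw [𝒢.s_unit, 𝒢.r_unit]) (by rw [h, 𝒢.r_unit])

theorem continuousOn_mul_inv :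
    ContinuousOn (fun p : G × G => 𝒢.mul p.1 (𝒢.inv p.2)) {p | 𝒢.s p.1 = 𝒢.s p.2} :=
  𝒢.continuousOn_mul.comp
    (continuous_fst.prodMk (𝒢.continuous_inv.comp continuous_snd)).continuousOn
    fun p (hp : 𝒢.s p.1 = 𝒢.s p.2) => hp.trans (𝒢.r_inv _).symm

theorem mul_inv_mul {x t : G} (h : 𝒢.r t = 𝒢.r x) :
    𝒢.mul x (𝒢.mul (𝒢.inv x) t) = t := by
  rw [← 𝒢.mul_assoc (𝒢.r_inv x).symm ((𝒢.s_inv x).trans h.symm), 𝒢.mul_inv, ← h, 𝒢.unit_mul]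

theorem r_inv_mul {x t : G} (h : 𝒢.r t = 𝒢.r x) : 𝒢.r (𝒢.mul (𝒢.inv x) t) = 𝒢.s x := by
  rw [𝒢.r_mul ((𝒢.s_inv x).trans h.symm), 𝒢.r_inv]

theorem s_inv_mul {x t : G} (h : 𝒢.r t = 𝒢.r x) : 𝒢.s (𝒢.mul (𝒢.inv x) t) = 𝒢.s t :=
  𝒢.s_mul ((𝒢.s_inv x).trans h.symm)

theorem mul_inv_inv_mul {x t : G} (h : 𝒢.r t = 𝒢.r x) :
    𝒢.mul t (𝒢.inv (𝒢.mul (𝒢.inv x) t)) = x := by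
  rw [𝒢.inv_inv_mul h]
  have := 𝒢.mul_assoc (x := t) (y := 𝒢.inv t) (z := x) (𝒢.r_inv t).symm ((𝒢.s_inv t).trans h)
  rw [← this, 𝒢.mul_inv, h, 𝒢.unit_mul]

end TopGroupoid

/-! ### Regular coefficients: supports, module structure, local units -/

section RegCoeff

variable {G X : Type u} [TopologicalSpace G] [TopologicalSpace X] [MeasurableSpace G]
  {𝒢 : TopGroupoid G X} (Λ : HaarSystem 𝒢)

theorem HaarSystem.ae_r_eq (a : X) : ∀ᵐ t ∂(Λ.meas a), 𝒢.r t = a := Λ.null_compl a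

/-- The integrand is nonzero at some `t` in the fiber; take `k = t` and `l = x⁻¹t`. Thus the nonzero
set of `(f, g)` lies in `{g ≠ 0}{f ≠ 0}⁻¹`, which controls supports. -/
theorem exists_of_regCoeff_ne_zero {f g : C_c(G, ℂ)} {x : G} (h : regCoeff Λ f g x ≠ 0) :
    ∃ k l : G, 𝒢.s k = 𝒢.s l ∧ g k ≠ 0 ∧ f l ≠ 0 ∧ 𝒢.mul k (𝒢.inv l) = x := by
  by_contra! hne
  refine h ?_
  have : ∀ᵐ t ∂(Λ.meas (𝒢.r x)), conj (f (𝒢.mul (𝒢.inv x) t)) * g t = 0 := by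
    filter_upwards [Λ.ae_r_eq (𝒢.r x)] with t ht
    by_contra h0
    rw [mul_eq_zero, not_or, map_eq_zero] at h0
    exact hne t _ (𝒢.s_inv_mul ht).symm h0.2 h0.1 (𝒢.mul_inv_inv_mul ht)
  exact (integral_congr_ae this).trans (integral_zero _ _)

theorem hasCompactSupport_of_mem_Acf [T2Space G] [T2Space X] {φ : G → ℂ} (hφ : φ ∈ Acf Λ) :
    HasCompactSupport φ := by
  obtain ⟨f, g, rfl⟩ := hφ
  have hcl : IsClosed {p : G × G | 𝒢.s p.1 = 𝒢.s p.2} :=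
    isClosed_eq (𝒢.continuous_s.comp continuous_fst) (𝒢.continuous_s.comp continuous_snd)
  have hK : IsCompact ((tsupport g ×ˢ tsupport f) ∩ {p : G × G | 𝒢.s p.1 = 𝒢.s p.2}) :=
    (g.hasCompactSupport.isCompact.prod f.hasCompactSupport.isCompact).inter_right hcl
  refine HasCompactSupport.of_support_subset_isCompact
    (hK.image_of_continuousOn (𝒢.continuousOn_mul_inv.mono inter_subset_right)) ?_
  intro x hx
  obtain ⟨k, l, hs, hk, hl, rfl⟩ := exists_of_regCoeff_ne_zero Λ hx
  exact ⟨(k, l), ⟨⟨subset_tsupport _ hk, subset_tsupport _ hl⟩, hs⟩, rfl⟩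

theorem mul_r_mem_Acf [LocallyCompactSpace G] [T2Space G] {φ : G → ℂ} (hφ : φ ∈ Acf Λ)
    {b : X → ℂ} (hb : Continuous b) : (fun x => φ x * b (𝒢.r x)) ∈ Acf Λ := by
  obtain ⟨f, g, rfl⟩ := hφ
  refine ⟨f, g.mulContinuous _ (hb.comp 𝒢.continuous_r), funext fun x => ?_⟩
  refine (integral_mul_const _ _).symm.trans (integral_congr_ae ?_)
  filter_upwards [Λ.ae_r_eq (𝒢.r x)] with t ht
  change _ = _ * (g t * b (𝒢.r t))
  rw [ht, mul_assoc]

/-- Since `r(x⁻¹t) = s(x)`, the factor can be absorbed into `f`; the conjugation compensates for the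
conjugate-linear variable. -/
theorem mul_s_mem_Acf [LocallyCompactSpace G] [T2Space G] {φ : G → ℂ} (hφ : φ ∈ Acf Λ)
    {b : X → ℂ} (hb : Continuous b) : (fun x => b (𝒢.s x) * φ x) ∈ Acf Λ := by
  obtain ⟨f, g, rfl⟩ := hφ
  refine ⟨f.mulContinuous _ (Complex.continuous_conj.comp (hb.comp 𝒢.continuous_r)), g,
    funext fun x => ?_⟩
  refine (integral_const_mul _ _).symm.trans (integral_congr_ae ?_)
  filter_upwards [Λ.ae_r_eq (𝒢.r x)] with t ht
  change _ = conj (f (𝒢.mul (𝒢.inv x) t) * conj (b (𝒢.r (𝒢.mul (𝒢.inv x) t)))) * g t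
  rw [𝒢.r_inv_mul ht, map_mul, Complex.conj_conj]
  ring

/-- Take `f` a bump at the unit `e` of `s(x)` and `g` equal to 1 on a neighborhood `Q` of `x`. For
`y` near `x`, `f(y⁻¹t) ≠ 0` forces `t = y(y⁻¹t)` into `Q`, so `(f, g)(y)` is the integral of
`f(y⁻¹t)`, which by left invariance depends on `s(y)` only. Dividing by it gives 1. -/
theorem exists_local_unit [LocallyCompactSpace G] [T2Space G] [BorelSpace G]
    [T2Space X] {x : G} {U : Set G} (hU : U ∈ 𝓝 x) :
    ∃ χ ∈ Acf Λ, tsupport χ ⊆ U ∧ ∀ᶠ y in 𝓝 x, χ y = 1 := by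
  set e := 𝒢.unit (𝒢.s x) with he
  have hse : 𝒢.s e = 𝒢.s x := 𝒢.s_unit _
  have hre : 𝒢.r e = 𝒢.s x := 𝒢.r_unit _
  obtain ⟨C, hCx, hCc, hCU⟩ := exists_mem_nhds_isClosed_subset hU
  -- neighborhoods `P` of `x` and `V` of `e` with `P V⁻¹ ⊆ C`
  obtain ⟨P, hP, V, hV, hPV⟩ : ∃ P ∈ 𝓝 x, ∃ V ∈ 𝓝 e, ∀ k ∈ P, ∀ l ∈ V, 𝒢.s k = 𝒢.s l →
      𝒢.mul k (𝒢.inv l) ∈ C := by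
    have hc := 𝒢.continuousOn_mul_inv (x, e) hse.symm
    have hval : 𝒢.mul x (𝒢.inv e) = x := by rw [he, 𝒢.inv_unit, 𝒢.mul_unit]
    have hmem := hc (show C ∈ 𝓝 (𝒢.mul x (𝒢.inv e)) by rwa [hval])
    rw [mem_map, mem_nhdsWithin_iff_eventually, nhds_prod_eq] at hmem
    obtain ⟨P, hP, V, hV, h⟩ := eventually_prod_iff.1 hmem
    exact ⟨{k | P k}, hP, {l | V l}, hV, fun k hk l hl hs => h hk hl hs⟩
  obtain ⟨Q, hQ, hQP, hQc⟩ := local_compact_nhds (interior_mem_nhds.2 hP)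
  -- neighborhoods `K` of `x` and `W` of `e` with `K W ⊆ Q`
  obtain ⟨K, hK, W, hW, hKW⟩ : ∃ K ∈ 𝓝 x, ∃ W ∈ 𝓝 e, ∀ k ∈ K, ∀ l ∈ W, 𝒢.s k = 𝒢.r l →
      𝒢.mul k l ∈ Q := by
    have hc := 𝒢.continuousOn_mul (x, e) hre.symm
    have hval : 𝒢.mul x e = x := 𝒢.mul_unit x
    have hmem := hc (show Q ∈ 𝓝 (𝒢.mul x e) by rwa [hval])
    rw [mem_map, mem_nhdsWithin_iff_eventually, nhds_prod_eq] at hmem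
    obtain ⟨P, hP, V, hV, h⟩ := eventually_prod_iff.1 hmem
    exact ⟨{k | P k}, hP, {l | V l}, hV, fun k hk l hl hs => h hk hl hs⟩
  obtain ⟨f, f', hff', hf'c, hf's, hf'0, hf'1, hf'V⟩ := exists_compactlySupported_bump
    (isCompact_singleton (x := e)) isOpen_interior
    (singleton_subset_iff.2 (mem_interior_iff_mem_nhds.2 (inter_mem hV hW)))
  have hfVW : ∀ y, f y ≠ 0 → y ∈ V ∩ W := fun y hy => by
    by_contra h
    exact hy (by rw [hff', hf'V y fun h' => h (interior_subset h'), Complex.ofReal_zero])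
  obtain ⟨g, g', hgg', -, -, -, hg'1, hg'P⟩ := exists_compactlySupported_bump hQc isOpen_interior hQP
  have hgP : ∀ y, g y ≠ 0 → y ∈ P := fun y hy => by
    by_contra h
    exact hy (by rw [hgg', hg'P y fun h' => h (interior_subset h'), Complex.ofReal_zero])
  set F : X → ℝ := fun a => ∫ t, f' t ∂(Λ.meas a) with hF
  have hFf : ∀ a, ∫ t, f t ∂(Λ.meas a) = F a := fun a => by
    simp_rw [hff']
    exact integral_ofReal
  have hFc : Continuous F := by
    have := Complex.continuous_re.comp (Λ.continuous_integral f)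
    simpa [Function.comp_def, hFf] using this
  have hF0 : 0 < F (𝒢.s x) := by
    refine (integral_pos_iff_support_of_nonneg hf'0
      (hf'c.integrable_of_hasCompactSupport hf's)).2 ?_
    refine Λ.pos_of_isOpen _ _ (hf'c.isOpen_support) ⟨e, ?_, hre⟩
    simp [hf'1 e rfl]
  -- The maximum keeps the denominator positive on all of `X` and equals `F` near `s x`.
  set c : X → ℂ := fun a => ((max (F a) (F (𝒢.s x) / 2))⁻¹ : ℝ) with hc
  have hcc : Continuous c := Complex.continuous_ofReal.comp
    ((hFc.max continuous_const).inv₀ fun a => ((half_pos hF0).trans_le (le_max_right _ _)).ne')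
  refine ⟨_, mul_s_mem_Acf Λ ⟨f, g, rfl⟩ hcc, ?_, ?_⟩
  · refine (closure_minimal (fun y hy => ?_) hCc).trans hCU
    obtain ⟨k, l, hs, hk, hl, rfl⟩ := exists_of_regCoeff_ne_zero Λ (right_ne_zero_of_mul hy)
    exact hPV k (hgP k hk) l (hfVW l hl).1 hs
  · have hlim : ∀ᶠ y in 𝓝 x, F (𝒢.s x) / 2 < F (𝒢.s y) :=
      (hFc.comp 𝒢.continuous_s).continuousAt.eventually (lt_mem_nhds (half_lt_self hF0))
    filter_upwards [hK, hlim] with y hy hFy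
    have hreg : regCoeff Λ f g y = F (𝒢.s y) := by
      rw [← hFf, ← 𝒢.r_inv y, ← Λ.left_invariant (𝒢.inv y) f, 𝒢.s_inv]
      refine integral_congr_ae ?_
      filter_upwards [Λ.ae_r_eq (𝒢.r y)] with t ht
      have hconj : conj (f (𝒢.mul (𝒢.inv y) t)) = f (𝒢.mul (𝒢.inv y) t) := by
        rw [hff', Complex.conj_ofReal]
      rw [hconj]
      by_cases h0 : f (𝒢.mul (𝒢.inv y) t) = 0
      · rw [h0, zero_mul]
      · have htQ := hKW y hy _ (hfVW _ h0).2 (𝒢.r_inv_mul ht).symm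
        rw [𝒢.mul_inv_mul ht] at htQ
        rw [hgg', hg'1 t htQ, Complex.ofReal_one, mul_one]
    rw [hreg, hc]
    simp only
    rw [max_eq_left hFy.le, ← Complex.ofReal_mul,
      inv_mul_cancel₀ ((half_pos hF0).trans hFy).ne', Complex.ofReal_one]

end RegCoeff

/-! ### Support points of a multiplicative module map -/

section Support

variable {G X : Type u} [TopologicalSpace G] [TopologicalSpace X] [MeasurableSpace G]
  {𝒢 : TopGroupoid G X} {Λ : HaarSystem 𝒢} {α β : fourierAlgebra Λ → C₀(X, ℂ)}

theorem Ac_subset_fourierAlgebra {φ : G → ℂ} (hφ : φ ∈ Ac Λ) : φ ∈ fourierAlgebra Λ :=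
  fun ε hε => ⟨φ, hφ, by rwa [sub_self, bNorm_zero]⟩

theorem Acf_subset_Ac {φ : G → ℂ} (hφ : φ ∈ Acf Λ) : φ ∈ Ac Λ :=
  NonUnitalAlgebra.subset_adjoin ℂ hφ

theorem sub_mem_fourierAlgebra {φ ψ : G → ℂ} (hφ : φ ∈ fourierAlgebra Λ) (hψ : ψ ∈ Ac Λ) :
    φ - ψ ∈ fourierAlgebra Λ := fun ε hε => by
  obtain ⟨χ, hχ, h⟩ := hφ ε hε
  exact ⟨χ - ψ, sub_mem hχ hψ, by rwa [sub_sub_sub_cancel_right]⟩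

theorem IsBoundedLinear.map_eq_zero (hα : IsBoundedLinear Λ α) {φ : fourierAlgebra Λ}
    (hφ : (φ : G → ℂ) = 0) : α φ = 0 := by
  rw [hα.map_smul 0 φ φ (by rw [zero_smul, hφ]), zero_smul]

/-- A bounded linear map on `A(G)` that does not vanish at a point does not vanish there on
`A_cf(G)` either, if it is multiplicative. -/
theorem IsBoundedLinear.exists_mem_Acf_apply_ne_zero (hα : IsBoundedLinear Λ α)
    (hm : IsMultiplicative Λ α) {a : X} {φ : fourierAlgebra Λ} (hφ : α φ a ≠ 0) :
    ∃ ψ : fourierAlgebra Λ, (ψ : G → ℂ) ∈ Acf Λ ∧ α ψ a ≠ 0 := by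
  by_contra! hne
  -- Evaluation of `α` at `a` is linear and multiplicative, so vanishing on generators passes to the
  -- algebra; boundedness then carries it to the closure.
  have key : ∀ ψ (hψ : ψ ∈ Ac Λ), α ⟨ψ, Ac_subset_fourierAlgebra hψ⟩ a = 0 := by
    intro ψ hψ
    induction hψ using NonUnitalAlgebra.adjoin_induction with
    | mem ψ h => exact hne ⟨ψ, _⟩ h
    | add ψ χ hψ hχ h1 h2 =>
      rw [hα.map_add ⟨ψ, Ac_subset_fourierAlgebra hψ⟩ ⟨χ, Ac_subset_fourierAlgebra hχ⟩ _ rfl,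
        ZeroAtInftyContinuousMap.add_apply, h1, h2, add_zero]
    | zero => rw [hα.map_eq_zero rfl, ZeroAtInftyContinuousMap.zero_apply]
    | mul ψ χ hψ hχ h1 h2 =>
      rw [hm ⟨ψ, Ac_subset_fourierAlgebra hψ⟩ ⟨χ, Ac_subset_fourierAlgebra hχ⟩ _ rfl,
        ZeroAtInftyContinuousMap.mul_apply, h1, zero_mul]
    | smul c ψ hψ h =>
      rw [hα.map_smul c ⟨ψ, Ac_subset_fourierAlgebra hψ⟩ _ rfl,
        ZeroAtInftyContinuousMap.smul_apply, h, smul_zero]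
  obtain ⟨C, hC⟩ := hα.bound
  have hpos : 0 < ‖α φ a‖ₑ := enorm_pos.2 hφ
  obtain ⟨ε, hε0, hε⟩ : ∃ ε : ℝ≥0∞, 0 < ε ∧ C * ε < ‖α φ a‖ₑ := by
    -- `C + 1` avoids division by zero when `C = 0`; the later halving gives a strict inequality.
    have h2 : (0 : ℝ≥0∞) < ‖α φ a‖ₑ / (C + 1) :=
      ENNReal.div_pos hpos.ne' (by simp)
    refine ⟨‖α φ a‖ₑ / (C + 1) / 2, ENNReal.half_pos h2.ne', ?_⟩
    have hfin : ‖α φ a‖ₑ / (C + 1) ≠ ∞ := ENNReal.div_ne_top (by simp) (by simp)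
    calc (C : ℝ≥0∞) * (‖α φ a‖ₑ / (C + 1) / 2)
        ≤ (C + 1) * (‖α φ a‖ₑ / (C + 1) / 2) := by gcongr; exact le_self_add
      _ < (C + 1) * (‖α φ a‖ₑ / (C + 1)) := by
        refine (ENNReal.mul_lt_mul_iff_right (by simp) (by simp)).2 (ENNReal.half_lt_self h2.ne' hfin)
      _ = ‖α φ a‖ₑ := ENNReal.mul_div_cancel (by simp) (by simp)
  obtain ⟨ψ, hψ, hlt⟩ := φ.2 ε hε0
  have hadd := hα.map_add ⟨ψ, Ac_subset_fourierAlgebra hψ⟩ ⟨_, sub_mem_fourierAlgebra φ.2 hψ⟩ φ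
    (by simp)
  have heval : α φ a = α ⟨_, sub_mem_fourierAlgebra φ.2 hψ⟩ a := by
    rw [hadd, ZeroAtInftyContinuousMap.add_apply, key ψ hψ, zero_add]
  refine absurd hε (not_lt.2 ?_)
  calc ‖α φ a‖ₑ ≤ ‖α ⟨_, sub_mem_fourierAlgebra φ.2 hψ⟩‖ₑ := by
        rw [heval]
        refine enorm_le_iff_norm_le.2 ?_
        rw [← ZeroAtInftyContinuousMap.norm_toBCF_eq_norm]
        exact BoundedContinuousFunction.norm_coe_le_norm
          (ZeroAtInftyContinuousMap.toBCF (α ⟨_, sub_mem_fourierAlgebra φ.2 hψ⟩)) a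
    _ ≤ C * bNorm 𝒢 ((φ : G → ℂ) - ψ) := hC _
    _ ≤ C * ε := by gcongr

/-- Each passage from `ψ` to `ψ - ψχᵢ` subtracts `α(ψ)α(χᵢ)`, which is zero on `T`. The factors `1 -
χᵢ` occur only multiplied by `φ`, so no unit in the algebra is needed. The set `T` allows both a
single point and all of `X`. -/
theorem IsMulRightModuleMap.exists_mem_Ac_mul_prod (hα : IsMulRightModuleMap Λ α) (T : Set X)
    {ι : Type*} (t : Finset ι) (χ : ι → fourierAlgebra Λ) (hχ : ∀ i, (χ i : G → ℂ) ∈ Ac Λ)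
    (h0 : ∀ i, ∀ b ∈ T, α (χ i) b = 0) {φ : fourierAlgebra Λ} (hφ : (φ : G → ℂ) ∈ Ac Λ) :
    ∃ ψ : fourierAlgebra Λ, (ψ : G → ℂ) ∈ Ac Λ ∧
      (∀ y, (ψ : G → ℂ) y = (φ : G → ℂ) y * ∏ i ∈ t, (1 - (χ i : G → ℂ) y)) ∧
      ∀ b ∈ T, α ψ b = α φ b := by
  classical
  induction t using Finset.induction_on with
  | empty => exact ⟨φ, hφ, by simp, fun _ _ => rfl⟩
  | insert i t hi ih =>
    obtain ⟨ψ, hψ, hval, hb⟩ := ih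
    have hp : (ψ : G → ℂ) * χ i ∈ Ac Λ := mul_mem hψ (hχ i)
    have hs : (ψ : G → ℂ) - ψ * χ i ∈ Ac Λ := sub_mem hψ hp
    refine ⟨⟨_, Ac_subset_fourierAlgebra hs⟩, hs, fun y => ?_, fun b hbT => ?_⟩
    · simp only [Pi.sub_apply, Pi.mul_apply]
      rw [hval, Finset.prod_insert hi]
      ring
    · have h1 := hα.boundedLinear.map_add ⟨_, Ac_subset_fourierAlgebra hs⟩
        ⟨_, Ac_subset_fourierAlgebra hp⟩ ψ (by simp)
      have h2 := hα.mul ψ (χ i) ⟨_, Ac_subset_fourierAlgebra hp⟩ rfl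
      rw [← hb b hbT, h1, h2, ZeroAtInftyContinuousMap.add_apply,
        ZeroAtInftyContinuousMap.mul_apply, h0 i b hbT, mul_zero, add_zero]

variable [T2Space G]

theorem IsMulRightModuleMap.eq_of_mem_supportSet (hα : IsMulRightModuleMap Λ α) {x y : G}
    (hx : x ∈ supportSet Λ α) (hy : y ∈ supportSet Λ α) (hxy : 𝒢.r x = 𝒢.r y) : x = y := by
  by_contra hne
  obtain ⟨V, W, hV, hW, hxV, hyW, hd⟩ := t2_separation hne
  obtain ⟨φ, ⟨hφ, hφV⟩, hφx⟩ := hx V (hV.mem_nhds hxV)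
  obtain ⟨ψ, ⟨hψ, hψW⟩, hψy⟩ := hy W (hW.mem_nhds hyW)
  have hp := mul_mem (Acf_subset_Ac hφ) (Acf_subset_Ac hψ)
  have h1 := hα.mul φ ψ ⟨_, Ac_subset_fourierAlgebra hp⟩ rfl
  have h0 : (φ : G → ℂ) * ψ = 0 := by
    funext z
    by_cases hz : z ∈ V
    · have : z ∉ tsupport (ψ : G → ℂ) := fun h => disjoint_left.1 hd hz (hψW h)
      rw [Pi.mul_apply, image_eq_zero_of_notMem_tsupport this, mul_zero, Pi.zero_apply]
    · have : z ∉ tsupport (φ : G → ℂ) := fun h => hz (hφV h)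
      rw [Pi.mul_apply, image_eq_zero_of_notMem_tsupport this, zero_mul, Pi.zero_apply]
  rw [hα.boundedLinear.map_eq_zero h0] at h1
  have h2 := DFunLike.congr_fun h1 (𝒢.r x)
  rw [ZeroAtInftyContinuousMap.zero_apply, ZeroAtInftyContinuousMap.mul_apply] at h2
  rcases mul_eq_zero.1 h2.symm with h | h
  · exact hφx h
  · exact hψy (hxy ▸ h)

variable [LocallyCompactSpace X] [T2Space X]

/-- Choose `φ` near `x`, away from `y`, with `α φ` nonzero at `r x`, and let `ψ` be supported near
`y` and over `{α φ ≠ 0}`. Where `α φ ≠ 0`, the relation `φψ = 0` gives `α ψ = 0`; elsewhere the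
module property does. -/
theorem IsMulRightModuleMap.mem_nullSet (hα : IsMulRightModuleMap Λ α) {x y : G}
    (hx : x ∈ supportSet Λ α) (hxy : 𝒢.r y = 𝒢.r x) (hne : y ≠ x) : y ∈ nullSet Λ α := by
  obtain ⟨V, W, hV, hW, hxV, hyW, hd⟩ := t2_separation hne.symm
  obtain ⟨φ, ⟨hφ, hφV⟩, hφx⟩ := hx V (hV.mem_nhds hxV)
  have hO : IsOpen {a | α φ a ≠ 0} := isOpen_ne_fun (map_continuous (α φ)) continuous_const
  refine ⟨W ∩ 𝒢.r ⁻¹' {a | α φ a ≠ 0}, hW.inter (hO.preimage 𝒢.continuous_r),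
    ⟨hyW, by rwa [mem_preimage, hxy]⟩, ?_⟩
  rintro ψ ⟨hψ, hψU⟩
  ext a
  rw [ZeroAtInftyContinuousMap.zero_apply]
  by_cases ha : α φ a = 0
  · have hK : IsCompact (tsupport (ψ : G → ℂ)) := hasCompactSupport_of_mem_Acf Λ hψ
    obtain ⟨b, hb1, hb0⟩ := exists_zeroAtInfty_bump (hK.image 𝒢.continuous_r) hO
      (image_subset_iff.2 fun z hz => (hψU hz).2)
    rw [hα.right b ψ ψ, ZeroAtInftyContinuousMap.mul_apply, hb0 a (not_not.2 ha), mul_zero]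
    funext z
    by_cases hz : z ∈ tsupport (ψ : G → ℂ)
    · rw [hb1 _ (mem_image_of_mem _ hz), mul_one]
    · rw [image_eq_zero_of_notMem_tsupport hz, zero_mul]
  · have hp := mul_mem (Acf_subset_Ac hφ) (Acf_subset_Ac hψ)
    have h1 := hα.mul φ ψ ⟨_, Ac_subset_fourierAlgebra hp⟩ rfl
    have h0 : (φ : G → ℂ) * ψ = 0 := by
      funext z
      by_cases hz : z ∈ V
      · have : z ∉ tsupport (ψ : G → ℂ) := fun h => disjoint_left.1 hd hz (hψU h).1
        rw [Pi.mul_apply, image_eq_zero_of_notMem_tsupport this, mul_zero, Pi.zero_apply]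
      · have : z ∉ tsupport (φ : G → ℂ) := fun h => hz (hφV h)
        rw [Pi.mul_apply, image_eq_zero_of_notMem_tsupport this, zero_mul, Pi.zero_apply]
    rw [hα.boundedLinear.map_eq_zero h0] at h1
    have h2 := DFunLike.congr_fun h1 a
    rw [ZeroAtInftyContinuousMap.zero_apply, ZeroAtInftyContinuousMap.mul_apply] at h2
    exact (mul_eq_zero.1 h2.symm).resolve_left ha

variable [LocallyCompactSpace G]

/-- If `α` vanishes on `T` locally along `S(φ) ∩ G^a`, then `α(φ)` vanishes on `T` near `a`. -/
theorem IsMulRightModuleMap.eventually_apply_eq_zero [BorelSpace G]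
    (hα : IsMulRightModuleMap Λ α) (T : Set X) (a : X) {φ : fourierAlgebra Λ}
    (hφ : (φ : G → ℂ) ∈ Acf Λ)
    (h : ∀ x ∈ tsupport (φ : G → ℂ), 𝒢.r x = a →
      ∃ U ∈ 𝓝 x, ∀ ψ ∈ AcfOn Λ U, ∀ b ∈ T, α ψ b = 0) :
    ∀ᶠ b in 𝓝 a, b ∈ T → α φ b = 0 := by
  have hK : IsCompact (tsupport (φ : G → ℂ)) := hasCompactSupport_of_mem_Acf Λ hφ
  have hloc : ∀ x : ↥(tsupport (φ : G → ℂ) ∩ 𝒢.rFiber a), ∃ χ : fourierAlgebra Λ,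
      (χ : G → ℂ) ∈ Ac Λ ∧ (∀ b ∈ T, α χ b = 0) ∧ ∀ᶠ y in 𝓝 (x : G), (χ : G → ℂ) y = 1 := by
    rintro ⟨x, hx, hxa⟩
    obtain ⟨U, hU, hUα⟩ := h x hx hxa
    obtain ⟨χ, hχ, hχU, hχ1⟩ := exists_local_unit Λ hU
    exact ⟨⟨χ, Acf_subset_fourierAlgebra Λ hχ⟩, Acf_subset_Ac hχ,
      hUα ⟨χ, Acf_subset_fourierAlgebra Λ hχ⟩ ⟨hχ, hχU⟩, hχ1⟩
  choose χ hχ hχα hχ1 using hloc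
  have hKa : IsCompact (tsupport (φ : G → ℂ) ∩ 𝒢.rFiber a) :=
    hK.inter_right (isClosed_singleton.preimage 𝒢.continuous_r)
  obtain ⟨t, ht⟩ := hKa.elim_finite_subcover
    (fun i => interior {y | (χ i : G → ℂ) y = 1}) (fun i => isOpen_interior)
    fun x hx => mem_iUnion.2 ⟨⟨x, hx⟩, mem_interior_iff_mem_nhds.2 (hχ1 ⟨x, hx⟩)⟩
  set W := ⋃ i ∈ t, interior {y | (χ i : G → ℂ) y = 1}
  have hW : IsOpen W := isOpen_biUnion fun i _ => isOpen_interior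
  -- The part of the support left uncovered by the local units is compact and misses the fiber over
  -- `a`, so a cut-off `b ∘ r` with `b = 1` near `a` removes it.
  have hcl : IsClosed (𝒢.r '' (tsupport (φ : G → ℂ) \ W)) :=
    ((hK.diff hW).image 𝒢.continuous_r).isClosed
  have ha : a ∈ (𝒢.r '' (tsupport (φ : G → ℂ) \ W))ᶜ := by
    rintro ⟨x, ⟨hx, hxW⟩, hxa⟩
    exact hxW (ht ⟨hx, hxa⟩)
  obtain ⟨L, hL, hLO, hLc⟩ := local_compact_nhds (hcl.isOpen_compl.mem_nhds ha)
  obtain ⟨b, hb1, hb0⟩ := exists_zeroAtInfty_bump hLc hcl.isOpen_compl hLO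
  have hφb := mul_r_mem_Acf Λ hφ (map_continuous b)
  obtain ⟨ψ, -, hval, hψ⟩ := hα.exists_mem_Ac_mul_prod T t χ hχ hχα
    (φ := ⟨_, Acf_subset_fourierAlgebra Λ hφb⟩) (Acf_subset_Ac hφb)
  -- On `W` some factor `1 - χᵢ` vanishes; on the rest of the support of `φ`, `b ∘ r` does.
  have hψ0 : (ψ : G → ℂ) = 0 := by
    funext y
    rw [hval, Pi.zero_apply]
    simp only
    by_cases hy : y ∈ tsupport (φ : G → ℂ)
    · by_cases hyW : y ∈ W
      · obtain ⟨i, hi, hyi⟩ := mem_iUnion₂.1 hyW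
        have h1 : (χ i : G → ℂ) y = 1 := (interior_subset hyi : y ∈ {y | (χ i : G → ℂ) y = 1})
        rw [Finset.prod_eq_zero hi (by rw [h1, sub_self]), mul_zero]
      · rw [hb0 _ (not_not.2 ⟨y, ⟨hy, hyW⟩, rfl⟩), mul_zero, zero_mul]
    · rw [image_eq_zero_of_notMem_tsupport hy, zero_mul, zero_mul]
  filter_upwards [hL] with c hc hcT
  have h1 := hψ c hcT
  rw [hα.boundedLinear.map_eq_zero hψ0, hα.right b φ _ rfl, ZeroAtInftyContinuousMap.mul_apply,
    hb1 c hc, mul_one] at h1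
  exact h1.symm

/-- The case `T = {a}`: failing to be a support point only gives vanishing at the single point `a`,
not near it. -/
theorem IsMulRightModuleMap.exists_mem_supportSet [BorelSpace G]
    (hα : IsMulRightModuleMap Λ α) {a : X} {φ : fourierAlgebra Λ} (hφ : (φ : G → ℂ) ∈ Acf Λ)
    (h : α φ a ≠ 0) : ∃ x ∈ supportSet Λ α, 𝒢.r x = a := by
  by_contra! hne
  refine h ((hα.eventually_apply_eq_zero {a} a hφ ?_).self_of_nhds rfl)
  rintro x - rfl
  have hx : x ∉ supportSet Λ α := fun hx => hne x hx rfl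
  simp only [supportSet, mem_ofPred_eq, not_forall, not_exists, not_and, not_not] at hx
  obtain ⟨V, hV, h0⟩ := hx
  refine ⟨V, hV, ?_⟩
  rintro ψ hψ b rfl
  exact h0 ψ hψ

theorem IsMulRightModuleMap.eventually_eq_zero_of_subset_nullSet [BorelSpace G]
    (hα : IsMulRightModuleMap Λ α) (a : X) {φ : fourierAlgebra Λ} (hφ : (φ : G → ℂ) ∈ Acf Λ)
    (h : tsupport (φ : G → ℂ) ∩ 𝒢.rFiber a ⊆ nullSet Λ α) : ∀ᶠ b in 𝓝 a, α φ b = 0 := by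
  refine (hα.eventually_apply_eq_zero univ a hφ fun x hx hxa => ?_).mono fun b hb => hb trivial
  obtain ⟨U, hU, hxU, h0⟩ := h ⟨hx, hxa⟩
  exact ⟨U, hU.mem_nhds hxU, fun ψ hψ b _ => by
    rw [h0 ψ hψ, ZeroAtInftyContinuousMap.zero_apply]⟩

theorem IsMulRightModuleMap.isOpen_baseSet [BorelSpace G] (hα : IsMulRightModuleMap Λ α) :
    IsOpen (baseSet Λ α) := by
  rw [isOpen_iff_mem_nhds]
  rintro _ ⟨x, hx, rfl⟩
  obtain ⟨φ, ⟨hφ, -⟩, hφx⟩ := hx univ univ_mem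
  filter_upwards [(map_continuous (α φ)).continuousAt.eventually_ne hφx] with a ha
  exact hα.exists_mem_supportSet hφ ha

/-- Let `φ`, supported in a neighborhood `V` of `x a`, have `α φ` nonzero at `p a`, hence at `p b`
for `b` near `a`. If `x b` were outside `V`, then `S(φ)` would meet the fiber over `p b` only in
null points, forcing `α φ (p b) = 0`. The map `p` covers both the inclusion of `A⁰` and the identity
of `X`. -/
theorem IsMulRightModuleMap.continuous_of_mem_supportSet [BorelSpace G]
    (hα : IsMulRightModuleMap Λ α) {Y : Type*} [TopologicalSpace Y] {p : Y → X} {x : Y → G}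
    (hp : Continuous p) (hx : ∀ a, x a ∈ supportSet Λ α) (hr : ∀ a, 𝒢.r (x a) = p a) :
    Continuous x := by
  rw [continuous_iff_continuousAt]
  intro a V hV
  obtain ⟨φ, ⟨hφ, hφV⟩, hφx⟩ := hx a V hV
  rw [hr] at hφx
  have hev := ((map_continuous (α φ)).comp hp).continuousAt.eventually_ne hφx
  rw [mem_map]
  filter_upwards [hev] with b hb
  by_contra hbV
  refine hb (hα.eventually_eq_zero_of_subset_nullSet (p b) hφ ?_).self_of_nhds
  rintro y ⟨hy, hyb⟩
  refine hα.mem_nullSet (hx b) ((show 𝒢.r y = p b from hyb).trans (hr b).symm) ?_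
  rintro rfl
  exact hbV (hφV hy)

theorem IsMulRightModuleMap.exists_support_section [BorelSpace G]
    (hα : IsMulRightModuleMap Λ α) : ∃ x : baseSet Λ α → G,
      (∀ a : baseSet Λ α, supportSet Λ α ∩ 𝒢.rFiber a = {x a}) ∧
      (∀ a : baseSet Λ α, 𝒢.rFiber a \ {x a} ⊆ nullSet Λ α) ∧
      (∀ a ∉ baseSet Λ α, ∀ φ ∈ AcfOn Λ univ, α φ a = 0) ∧
      (∀ (a : X), ∀ φ ∈ AcfOn Λ univ,
        tsupport (φ : G → ℂ) ∩ 𝒢.rFiber a ⊆ nullSet Λ α → ∀ᶠ b in 𝓝 a, α φ b = 0) ∧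
      IsOpen (baseSet Λ α) ∧
      Continuous x ∧
      (∀ φ ∈ AcfOn Λ univ, tsupport (φ : G → ℂ) ⊆ (range x)ᶜ → α φ = 0) := by
  have hex : ∀ a : baseSet Λ α, ∃ y ∈ supportSet Λ α, 𝒢.r y = a := fun a => a.2
  choose x hxA hxr using hex
  have hnull : ∀ a : baseSet Λ α, 𝒢.rFiber a \ {x a} ⊆ nullSet Λ α := fun a y hy =>
    hα.mem_nullSet (hxA a) ((show 𝒢.r y = a from hy.1).trans (hxr a).symm) hy.2
  have hzero : ∀ a ∉ baseSet Λ α, ∀ φ ∈ AcfOn Λ univ, α φ a = 0 := fun a ha φ hφ => by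
    by_contra h
    exact ha (hα.exists_mem_supportSet hφ.1 h)
  refine ⟨x, fun a => ?_, hnull, hzero,
    fun a φ hφ h => hα.eventually_eq_zero_of_subset_nullSet a hφ.1 h, hα.isOpen_baseSet,
    hα.continuous_of_mem_supportSet continuous_subtype_val hxA hxr, fun φ hφ h => ?_⟩
  · ext y
    refine ⟨fun hy => hα.eq_of_mem_supportSet hy.1 (hxA a)
      ((show 𝒢.r y = a from hy.2).trans (hxr a).symm), ?_⟩
    rintro rfl
    exact ⟨hxA a, hxr a⟩
  · ext a
    rw [ZeroAtInftyContinuousMap.zero_apply]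
    by_cases ha : a ∈ baseSet Λ α
    · refine (hα.eventually_eq_zero_of_subset_nullSet a hφ.1 ?_).self_of_nhds
      rintro y ⟨hy, hya⟩
      refine hnull ⟨a, ha⟩ ⟨hya, ?_⟩
      rintro rfl
      exact h hy (mem_range_self _)
    · exact hzero a ha φ hφ

/-! ### Linked pairs and the bisection -/

/-- The homeomorphism linking `α` and `β` carries the range of a support point of `α`
to its source. -/
theorem IsMulModuleMap.s_eq_of_mem_supportSet [BorelSpace G] (h : IsMulModuleMap Λ α β) {J : X ≃ₜ X}
    (hJ : ∀ (φ : fourierAlgebra Λ) (a : X), β φ (J a) = α φ a) {x : G}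
    (hx : x ∈ supportSet Λ α) : 𝒢.s x = J (𝒢.r x) := by
  by_contra hne
  have hd : {𝒢.s x}ᶜ ∈ 𝓝 (J (𝒢.r x)) := isOpen_compl_singleton.mem_nhds fun h => hne h.symm
  obtain ⟨L, hL, hLO, hLc⟩ := local_compact_nhds hd
  obtain ⟨b, hb1, hb0⟩ := exists_zeroAtInfty_bump (isCompact_singleton (x := J (𝒢.r x)))
    isOpen_interior (singleton_subset_iff.2 (mem_interior_iff_mem_nhds.2 hL))
  -- For `φ` supported here `bφ = 0`, although `β(bφ)` at `J (r x)` equals `α φ (r x)`, which can be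
  -- chosen nonzero.
  have hV : 𝒢.s ⁻¹' Lᶜ ∈ 𝓝 x := 𝒢.continuous_s.continuousAt.preimage_mem_nhds
    (hLc.isClosed.isOpen_compl.mem_nhds fun h => hLO h rfl)
  obtain ⟨φ, ⟨hφ, hφV⟩, hφx⟩ := hx _ hV
  have hbφ := mul_s_mem_Acf Λ hφ (map_continuous b)
  have h1 := h.left b φ ⟨_, Acf_subset_fourierAlgebra Λ hbφ⟩ rfl
  rw [h.boundedLinear_snd.map_eq_zero] at h1
  · have h2 := DFunLike.congr_fun h1 (J (𝒢.r x))
    rw [ZeroAtInftyContinuousMap.zero_apply, ZeroAtInftyContinuousMap.mul_apply, hb1 _ rfl,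
      one_mul, hJ] at h2
    exact hφx h2.symm
  · funext z
    by_cases hz : z ∈ tsupport (φ : G → ℂ)
    · change b (𝒢.s z) * _ = 0
      rw [hb0 _ fun h => hφV hz (interior_subset h), zero_mul]
    · change _ * (φ : G → ℂ) z = 0
      rw [image_eq_zero_of_notMem_tsupport hz, mul_zero]

theorem IsMulModuleMap.s_eq_of_mem_sSupportSet [BorelSpace G] (h : IsMulModuleMap Λ α β) {J : X ≃ₜ X}
    (hJ : ∀ (φ : fourierAlgebra Λ) (a : X), β φ (J a) = α φ a) {x : G}
    (hx : x ∈ sSupportSet Λ β) : 𝒢.s x = J (𝒢.r x) := by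
  rw [← J.symm_apply_eq]
  by_contra hne
  have hd : {𝒢.r x}ᶜ ∈ 𝓝 (J.symm (𝒢.s x)) := isOpen_compl_singleton.mem_nhds hne
  obtain ⟨L, hL, hLO, hLc⟩ := local_compact_nhds hd
  obtain ⟨b, hb1, hb0⟩ := exists_zeroAtInfty_bump (isCompact_singleton (x := J.symm (𝒢.s x)))
    isOpen_interior (singleton_subset_iff.2 (mem_interior_iff_mem_nhds.2 hL))
  have hV : 𝒢.r ⁻¹' Lᶜ ∈ 𝓝 x := 𝒢.continuous_r.continuousAt.preimage_mem_nhds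
    (hLc.isClosed.isOpen_compl.mem_nhds fun h => hLO h rfl)
  obtain ⟨φ, ⟨hφ, hφV⟩, hφx⟩ := hx _ hV
  have hbφ := mul_r_mem_Acf Λ hφ (map_continuous b)
  have h1 := h.right b φ ⟨_, Acf_subset_fourierAlgebra Λ hbφ⟩ rfl
  rw [h.boundedLinear_fst.map_eq_zero] at h1
  · have h2 := DFunLike.congr_fun h1 (J.symm (𝒢.s x))
    rw [ZeroAtInftyContinuousMap.zero_apply, ZeroAtInftyContinuousMap.mul_apply, hb1 _ rfl,
      mul_one, ← hJ, J.apply_symm_apply] at h2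
    exact hφx h2.symm
  · funext z
    by_cases hz : z ∈ tsupport (φ : G → ℂ)
    · change _ * b (𝒢.r z) = 0
      rw [hb0 _ fun h => hφV hz (interior_subset h), mul_zero]
    · change (φ : G → ℂ) z * _ = 0
      rw [image_eq_zero_of_notMem_tsupport hz, zero_mul]

/-- On both sets `s x = J (r x)`, so `β φ (s x) = α φ (r x)` and the two defining conditions agree.
-/
theorem IsMulModuleMap.sSupportSet_eq [BorelSpace G] (h : IsMulModuleMap Λ α β) {J : X ≃ₜ X}
    (hJ : ∀ (φ : fourierAlgebra Λ) (a : X), β φ (J a) = α φ a) :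
    sSupportSet Λ β = supportSet Λ α := by
  ext x
  refine ⟨fun hx V hV => ?_, fun hx V hV => ?_⟩ <;> obtain ⟨φ, hφ, hφx⟩ := hx V hV <;>
    refine ⟨φ, hφ, ?_⟩
  · rwa [← hJ, ← h.s_eq_of_mem_sSupportSet hJ hx]
  · rwa [h.s_eq_of_mem_supportSet hJ hx, hJ]

theorem IsMulModuleMap.exists_bisection [BorelSpace G] (h : IsMulModuleMap Λ α β) :
    ∃ γ δ : X → G,
      (∀ a, supportSet Λ α ∩ 𝒢.rFiber a = {γ a}) ∧
      (∀ a, sSupportSet Λ β ∩ 𝒢.sFiber a = {δ a}) ∧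
      ∃ B : Set G, 𝒢.IsBisection B ∧
        ∃ ρ σ : B ≃ₜ X,
          (∀ x : B, ρ x = 𝒢.r x) ∧ (∀ x : B, σ x = 𝒢.s x) ∧
          (∀ a, γ a = ρ.symm a) ∧ (∀ a, δ a = σ.symm a) := by
  have hα : IsMulRightModuleMap Λ α := ⟨h.boundedLinear_fst, h.right, h.mul⟩
  obtain ⟨J, hJ⟩ := h.linked
  have hex : ∀ a : X, ∃ x ∈ supportSet Λ α, 𝒢.r x = a := fun a => by
    obtain ⟨φ, hφ⟩ := h.nonvanishing a
    obtain ⟨ψ, hψ, hne⟩ := h.boundedLinear_fst.exists_mem_Acf_apply_ne_zero h.mul hφ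
    exact hα.exists_mem_supportSet hψ hne
  choose γ hγA hγr using hex
  have hγc : Continuous γ := hα.continuous_of_mem_supportSet continuous_id hγA hγr
  have huniq : ∀ x ∈ supportSet Λ α, x = γ (𝒢.r x) := fun x hx =>
    hα.eq_of_mem_supportSet hx (hγA _) (hγr _).symm
  let ρ : supportSet Λ α ≃ₜ X :=
    { toFun := fun x => 𝒢.r x
      invFun := fun a => ⟨γ a, hγA a⟩
      left_inv := fun x => Subtype.ext (huniq x x.2).symm
      right_inv := hγr
      continuous_toFun := 𝒢.continuous_r.comp continuous_subtype_val
      continuous_invFun := hγc.subtype_mk _ }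
  have hs : ∀ x ∈ supportSet Λ α, 𝒢.s x = J (𝒢.r x) := fun x hx =>
    h.s_eq_of_mem_supportSet hJ hx
  have hR : ∀ a, supportSet Λ α ∩ 𝒢.rFiber a = {γ a} := fun a => by
    ext x
    refine ⟨fun hx => (huniq x hx.1).trans (congrArg γ hx.2), ?_⟩
    rintro rfl
    exact ⟨hγA a, hγr a⟩
  -- Because `s = J ∘ r` on the support set, its points with source `a` are those with range
  -- `J⁻¹(a)`.
  have hS : ∀ a, supportSet Λ α ∩ 𝒢.sFiber a = {γ (J.symm a)} := fun a => by
    rw [← hR]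
    ext x
    refine and_congr_right fun hx => ?_
    change 𝒢.s x = a ↔ 𝒢.r x = J.symm a
    rw [hs x hx, J.eq_symm_apply]
  refine ⟨γ, γ ∘ J.symm, hR, ?_, supportSet Λ α, ⟨⟨ρ.symm, hR⟩, ⟨(ρ.trans J).symm, hS⟩⟩, ρ,
    ρ.trans J, fun _ => rfl, fun x => (hs x x.2).symm, fun _ => rfl, fun _ => rfl⟩
  rw [h.sSupportSet_eq hJ]
  exact hS

end Support

theorem mainTheorem10 {G X : Type u}
    [TopologicalSpace G] [LocallyCompactSpace G] [T2Space G] [SecondCountableTopology G]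
    [MeasurableSpace G] [BorelSpace G]
    [TopologicalSpace X] [LocallyCompactSpace X] [T2Space X] [SecondCountableTopology X]
    (𝒢 : TopGroupoid G X) (Λ : HaarSystem 𝒢) :
    (∀ α : fourierAlgebra Λ → C₀(X, ℂ), IsMulRightModuleMap Λ α →
      ∃ x : baseSet Λ α → G,
        (∀ a : baseSet Λ α, supportSet Λ α ∩ 𝒢.rFiber a = {x a}) ∧
        (∀ a : baseSet Λ α, 𝒢.rFiber a \ {x a} ⊆ nullSet Λ α) ∧
        (∀ a ∉ baseSet Λ α, ∀ φ ∈ AcfOn Λ univ, α φ a = 0) ∧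
        (∀ (a : X), ∀ φ ∈ AcfOn Λ univ,
          tsupport (φ : G → ℂ) ∩ 𝒢.rFiber a ⊆ nullSet Λ α → ∀ᶠ b in 𝓝 a, α φ b = 0) ∧
        IsOpen (baseSet Λ α) ∧
        Continuous x ∧
        (∀ φ ∈ AcfOn Λ univ, tsupport (φ : G → ℂ) ⊆ (range x)ᶜ → α φ = 0)) ∧
    (∀ α β : fourierAlgebra Λ → C₀(X, ℂ), IsMulModuleMap Λ α β →
      ∃ γ δ : X → G,
        (∀ a, supportSet Λ α ∩ 𝒢.rFiber a = {γ a}) ∧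
        (∀ a, sSupportSet Λ β ∩ 𝒢.sFiber a = {δ a}) ∧
        ∃ B : Set G, 𝒢.IsBisection B ∧
          ∃ ρ σ : B ≃ₜ X,
            (∀ x : B, ρ x = 𝒢.r x) ∧ (∀ x : B, σ x = 𝒢.s x) ∧
            (∀ a, γ a = ρ.symm a) ∧ (∀ a, δ a = σ.symm a)) :=
  ⟨fun _ hα => hα.exists_support_section, fun _ _ h => h.exists_bisection⟩
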